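/- Let $Y_1,Y_2,\dots$ be i.i.d. random elements of a measurable space $\mathbb Y$, defined on a probability space with probability $P_0$, and let $l_1,l_2,\dots:\mathbb Y\to\mathbb R$ be measurable functions such that $E_0\,l_j(Y_1)=0$ for every $j$ and, for every $k\ge 1$, the vector $(l_1(Y_1),\dots,l_k(Y_1))$ has the identity covariance matrix and satisfies $\|(l_1(Y_1),\dots,l_k(Y_1))\|\le M(k)$ almost surely, where $\|\cdot\|$ is the Euclidean norm and $M(k)$ is a real number. For $n,k\ge 1$ let $$T_k=T_k(Y_1,\dots,Y_n)=\sum_{j=1}^k\Bigl\{\frac1{\sqrt n}\sum_{i=1}^n l_j(Y_i)\Bigr\}^2$$ be the SNT-statistic of dimension $k$. For each sample size $n\ge1$ let $d(n)\ge 1$ be an integer and let $\pi(k,n)$, $1\le k\le d(n)$, be nonnegative real penalties with $\pi(1,n)<\pi(2,n)<\dots<\pi(d(n),n)$ and such that, for every fixed $j\ge2$, $\pi(j,n)-\pi(1,n)\to\infty$ as $n\to\infty$ (along those $n$ with $d(n)\ge j$). Let $$S=S(n)=\min\bigl\{k:\ 1\le k\le d(n),\ T_k-\pi(k,n)\ge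 T_j-\pi(j,n)\ \text{for all } j=1,\dots,d(n)\bigr\}$$ be the selection rule. Assume that $\pi(k,n)-\pi(1,n)\ge 2k$ for all $n\ge1$ and $2\le k\le d(n)$, and that $$\lim_{n\to\infty}\frac{M(d(n))\,\pi(d(n),n)}{\sqrt n}=0 .$$ Then, as $n\to\infty$, $S=O_{P_0}(1)$ and $T_S=O_{P_0}(1)$; that is, for every $\varepsilon>0$ there is a constant $C$ such that $P_0(S\ge C)\le\varepsilon$ and $P_0(T_S\ge C)\le\varepsilon$ for all sufficiently large $n$. -/

import Mathlib

open MeasureTheory ProbabilityTheory Filter Topology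

noncomputable section

/-- The SNT-statistic `T_k` based on `n` observations. Sequences are indexed from `0`, so `Y i` is
the observation `Y_{i+1}` and `l j` is the function `l_{j+1}`. -/
def sntStatistic {Ω 𝕐 : Type*} (l : ℕ → 𝕐 → ℝ) (Y : ℕ → Ω → 𝕐) (n k : ℕ) (ω : Ω) : ℝ :=
  ∑ j ∈ Finset.range k, ((1 / √(n : ℝ)) * ∑ i ∈ Finset.range n, l j (Y i ω)) ^ 2

/-- `d` is a sequence of maximal dimensions and `π k n` is a penalty attributed to the `k`-th
model (`1 ≤ k ≤ d n`) and the sample size `n ≥ 1`. In the last condition the limit is taken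
along those `n` for which the `j`-th model is present. -/
structure IsPenalty (d : ℕ → ℕ) (π : ℕ → ℕ → ℝ) : Prop where
  one_le : ∀ n, 1 ≤ n → 1 ≤ d n
  strictMonoOn : ∀ n, 1 ≤ n → StrictMonoOn (fun k => π k n) (Set.Icc 1 (d n))
  tendsto : ∀ j, 2 ≤ j →
    Tendsto (fun n => π j n - π 1 n) (atTop ⊓ 𝓟 {n | j ≤ d n}) atTop

/-- The selection rule `S` for statistics `T n k` (sample size `n`, dimension `k`): the smallest
`k` in `{1, …, d n}` that maximizes `T_k - π(k, n)` over this set. -/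
def selectionRule {Ω : Type*} (d : ℕ → ℕ) (π : ℕ → ℕ → ℝ) (T : ℕ → ℕ → Ω → ℝ)
    (n : ℕ) (ω : Ω) : ℕ :=
  sInf {k | k ∈ Set.Icc 1 (d n) ∧ ∀ j ∈ Set.Icc 1 (d n), T n k ω - π k n ≥ T n j ω - π j n}

/-- `X n = O_P(1)` as `n → ∞`. -/
def IsBoundedInProbability {Ω : Type*} [MeasurableSpace Ω] (P : Measure Ω)
    (X : ℕ → Ω → ℝ) : Prop :=
  ∀ ε : ℝ, 0 < ε → ∃ C : ℝ, ∀ᶠ n in atTop, P.real {ω | C ≤ |X n ω|} ≤ ε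

end

/-! Comparing `S` with dimension 1 and using `T_1 ≥ 0`, the penalty gap forces `T_S ≥ 2S` as soon as
`S ≥ 2`. But `T_k` has mean `k` and, once `M(d(n))² ≤ n`, variance at most `3k`, so such a value is
a large deviation of order `k`. A union bound over all `k` would give the divergent series `∑ 1/k`.
Since `T_k` increases in `k`, it is enough to look at the ends of the blocks `[m², (m+1)²)`; there
Chebyshev gives `O(m⁻²)`, which is summable, so `S` is tight (`measureReal_selectionRule_ge_le`).
Then `T_S ≤ T_N` on `S ≤ N`, and Markov's inequality handles `T_N`.

The variance bound is proved by adding one observation at a time (`integral_sq_sum_sq_add_sub_le`),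
so no fourth moments need expanding. -/

open scoped ENNReal

/-! ### Second moments of squared norms under an independent increment. -/

section SecondMoment

variable {Ω ι : Type*} [MeasurableSpace Ω] {P : Measure Ω}

lemma memLp_top_fun_mul {f g : Ω → ℝ} (hf : MemLp f ∞ P) (hg : MemLp g ∞ P) :
    MemLp (fun ω => f ω * g ω) ∞ P :=
  hg.mul (p := ∞) (q := ∞) (r := ∞) hf

lemma memLp_top_fun_sq {f : Ω → ℝ} (hf : MemLp f ∞ P) : MemLp (fun ω => f ω ^ 2) ∞ P := by
  simpa only [sq] using memLp_top_fun_mul hf hf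

lemma memLp_top_sum_sq (K : Finset ι) {f : ι → Ω → ℝ} (hf : ∀ j, MemLp (f j) ∞ P) :
    MemLp (fun ω => ∑ j ∈ K, f j ω ^ 2) ∞ P :=
  memLp_finsetSum K fun j _ => memLp_top_fun_sq (hf j)

lemma integral_fun_mul_of_indepFun_pi [Countable ι] {s ξ : ι → Ω → ℝ}
    (hs : ∀ j, AEMeasurable (s j) P) (hξ : ∀ j, AEMeasurable (ξ j) P)
    (hind : IndepFun (fun ω j => s j ω) (fun ω j => ξ j ω) P)
    {F G : (ι → ℝ) → ℝ} (hF : Measurable F) (hG : Measurable G) :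
    ∫ ω, F (fun j => s j ω) * G (fun j => ξ j ω) ∂P =
      (∫ ω, F (fun j => s j ω) ∂P) * ∫ ω, G (fun j => ξ j ω) ∂P :=
  hind.integral_fun_comp_mul_comp (aemeasurable_pi_iff.2 hs) (aemeasurable_pi_iff.2 hξ)
    hF.aestronglyMeasurable hG.aestronglyMeasurable

lemma integral_sum_sq_of_isotropic [IsProbabilityMeasure P] [DecidableEq ι] (K : Finset ι)
    {ξ : ι → Ω → ℝ} (hξ : ∀ j, MemLp (ξ j) ∞ P)
    (hcov : ∀ i j, ∫ ω, ξ i ω * ξ j ω ∂P = if i = j then 1 else 0) :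
    ∫ ω, ∑ j ∈ K, ξ j ω ^ 2 ∂P = K.card := by
  rw [integral_finsetSum K fun j _ => (memLp_top_fun_sq (hξ j)).integrable le_top]
  simp [sq, hcov]

/-- Adding an independent isotropic vector increases the mean squared norm by the dimension. -/
lemma integral_sum_sq_add [IsProbabilityMeasure P] [DecidableEq ι] [Countable ι]
    (K : Finset ι) {s ξ : ι → Ω → ℝ}
    (hs : ∀ j, MemLp (s j) ∞ P) (hξ : ∀ j, MemLp (ξ j) ∞ P)
    (hind : IndepFun (fun ω j => s j ω) (fun ω j => ξ j ω) P)
    (hξ0 : ∀ j, ∫ ω, ξ j ω ∂P = 0)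
    (hcov : ∀ i j, ∫ ω, ξ i ω * ξ j ω ∂P = if i = j then 1 else 0) :
    ∫ ω, ∑ j ∈ K, (s j ω + ξ j ω) ^ 2 ∂P = ∫ ω, ∑ j ∈ K, s j ω ^ 2 ∂P + K.card := by
  have hL : MemLp (fun ω => ∑ j ∈ K, s j ω * ξ j ω) ∞ P :=
    memLp_finsetSum K fun j _ => memLp_top_fun_mul (hs j) (hξ j)
  have hL0 : ∫ ω, ∑ j ∈ K, s j ω * ξ j ω ∂P = 0 := by
    rw [integral_finsetSum K fun j _ => (memLp_top_fun_mul (hs j) (hξ j)).integrable le_top]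
    refine Finset.sum_eq_zero fun j _ => ?_
    rw [integral_fun_mul_of_indepFun_pi (fun j => (hs j).aemeasurable)
      (fun j => (hξ j).aemeasurable) hind (measurable_pi_apply j) (measurable_pi_apply j), hξ0,
      mul_zero]
  have h1 := (memLp_top_sum_sq K hs).integrable le_top
  have h2 := hL.integrable le_top
  have h3 := (memLp_top_sum_sq K hξ).integrable le_top
  calc ∫ ω, ∑ j ∈ K, (s j ω + ξ j ω) ^ 2 ∂P
      = ∫ ω, (∑ j ∈ K, s j ω ^ 2 + 2 * ∑ j ∈ K, s j ω * ξ j ω) + ∑ j ∈ K, ξ j ω ^ 2 ∂P := by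
        congr 1 with ω
        rw [Finset.mul_sum, ← Finset.sum_add_distrib, ← Finset.sum_add_distrib]
        exact Finset.sum_congr rfl fun j _ => by ring
    _ = _ := by
        rw [integral_add (h1.fun_add (h2.const_mul 2)) h3, integral_add h1 (h2.const_mul 2),
          integral_const_mul, hL0, integral_sum_sq_of_isotropic K hξ hcov]
        ring

/-- If `s` and `ξ` are independent, bounded and centred and `ξ` is isotropic, then adding `ξ` to `s`
increases the second moment of the recentred squared norm in a controlled way. -/
lemma integral_sq_sum_sq_add_sub_le [IsProbabilityMeasure P] [DecidableEq ι] [Countable ι]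
    (K : Finset ι) {s ξ : ι → Ω → ℝ}
    (hs : ∀ j, MemLp (s j) ∞ P) (hξ : ∀ j, MemLp (ξ j) ∞ P)
    (hind : IndepFun (fun ω j => s j ω) (fun ω j => ξ j ω) P)
    (hs0 : ∀ j, ∫ ω, s j ω ∂P = 0) (hξ0 : ∀ j, ∫ ω, ξ j ω ∂P = 0)
    (hcov : ∀ i j, ∫ ω, ξ i ω * ξ j ω ∂P = if i = j then 1 else 0)
    {B : ℝ} (hB : ∀ᵐ ω ∂P, ∑ j ∈ K, ξ j ω ^ 2 ≤ B) (c : ℝ) :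
    ∫ ω, (∑ j ∈ K, (s j ω + ξ j ω) ^ 2 - (c + K.card)) ^ 2 ∂P ≤
      ∫ ω, (∑ j ∈ K, s j ω ^ 2 - c) ^ 2 ∂P + 4 * ∫ ω, ∑ j ∈ K, s j ω ^ 2 ∂P + K.card * B := by
  have mulE {F G : (ι → ℝ) → ℝ} (hF : Measurable F) (hG : Measurable G) :=
    integral_fun_mul_of_indepFun_pi (fun j => (hs j).aemeasurable)
      (fun j => (hξ j).aemeasurable) hind hF hG
  set Q : Ω → ℝ := fun ω => ∑ j ∈ K, s j ω ^ 2 - c with hQ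
  set L : Ω → ℝ := fun ω => ∑ j ∈ K, s j ω * ξ j ω with hL
  set R : Ω → ℝ := fun ω => ∑ j ∈ K, ξ j ω ^ 2 - K.card with hR
  have mQ : MemLp Q ∞ P := (memLp_top_sum_sq K hs).sub (memLp_const _)
  have mL : MemLp L ∞ P := memLp_finsetSum K fun j _ => memLp_top_fun_mul (hs j) (hξ j)
  have mR : MemLp R ∞ P := (memLp_top_sum_sq K hξ).sub (memLp_const _)
  have iX := (memLp_top_sum_sq K hξ).integrable le_top
  have R0 : ∫ ω, R ω ∂P = 0 := by
    simp only [hR]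
    rw [integral_sub iX (integrable_const _), integral_sum_sq_of_isotropic K hξ hcov]
    simp
  have QL0 : ∫ ω, Q ω * L ω ∂P = 0 := by
    have (ω : Ω) : Q ω * L ω = ∑ j ∈ K, (Q ω * s j ω) * ξ j ω := by
      simp only [hL, Finset.mul_sum, mul_assoc]
    simp_rw [this]
    rw [integral_finsetSum K fun j _ =>
      (memLp_top_fun_mul (memLp_top_fun_mul mQ (hs j)) (hξ j)).integrable le_top]
    refine Finset.sum_eq_zero fun j _ => ?_
    have := mulE (F := fun x => (∑ j ∈ K, x j ^ 2 - c) * x j) (G := fun x => x j)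
      (by fun_prop) (by fun_prop)
    simp only [hQ]
    rw [this, hξ0, mul_zero]
  have QR0 : ∫ ω, Q ω * R ω ∂P = 0 := by
    have := mulE (F := fun x => ∑ j ∈ K, x j ^ 2 - c) (G := fun x => ∑ j ∈ K, x j ^ 2 - K.card)
      (by fun_prop) (by fun_prop)
    refine this.trans ?_
    rw [show ∫ ω, (∑ j ∈ K, ξ j ω ^ 2 - K.card) ∂P = 0 from R0, mul_zero]
  -- Third moments of `ξ` need not vanish; this term dies because it is linear in the centred `s`.
  have LR0 : ∫ ω, L ω * R ω ∂P = 0 := by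
    have (ω : Ω) : L ω * R ω = ∑ j ∈ K, s j ω * (ξ j ω * R ω) := by
      simp only [hL, Finset.sum_mul, mul_assoc]
    simp_rw [this]
    rw [integral_finsetSum K fun j _ =>
      (memLp_top_fun_mul (hs j) (memLp_top_fun_mul (hξ j) mR)).integrable le_top]
    refine Finset.sum_eq_zero fun j _ => ?_
    have := mulE (F := fun x => x j) (G := fun x => x j * (∑ j ∈ K, x j ^ 2 - K.card))
      (by fun_prop) (by fun_prop)
    simp only [hR]
    rw [this, hs0, zero_mul]
  have LL : ∫ ω, L ω ^ 2 ∂P = ∫ ω, ∑ j ∈ K, s j ω ^ 2 ∂P := by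
    have (ω : Ω) : L ω ^ 2 = ∑ i ∈ K, ∑ j ∈ K, (s i ω * s j ω) * (ξ i ω * ξ j ω) := by
      simp only [hL, sq, Finset.sum_mul_sum]
      exact Finset.sum_congr rfl fun i _ => Finset.sum_congr rfl fun j _ => by ring
    simp_rw [this]
    have hm (i j : ι) : MemLp (fun ω => (s i ω * s j ω) * (ξ i ω * ξ j ω)) ∞ P :=
      memLp_top_fun_mul (memLp_top_fun_mul (hs i) (hs j)) (memLp_top_fun_mul (hξ i) (hξ j))
    rw [integral_finsetSum K fun i _ =>
        (memLp_finsetSum K fun j _ => hm i j).integrable le_top,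
      integral_finsetSum K fun j _ => (memLp_top_fun_sq (hs j)).integrable le_top]
    refine Finset.sum_congr rfl fun i hi => ?_
    rw [integral_finsetSum K fun j _ => (hm i j).integrable le_top]
    have (j : ι) : ∫ ω, (s i ω * s j ω) * (ξ i ω * ξ j ω) ∂P =
        if i = j then ∫ ω, s i ω * s j ω ∂P else 0 := by
      rw [mulE (F := fun x => x i * x j) (G := fun x => x i * x j) (by fun_prop) (by fun_prop),
        hcov]
      simp
    simp [this, hi, sq]
  have RR : ∫ ω, R ω ^ 2 ∂P ≤ K.card * B := by
    -- With `X = ∑ ξ_j²`, `R² = X² - 2·card·R - card²`, and `X² ≤ B X` almost surely.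
    have h1 : ∫ ω, R ω ^ 2 ∂P ≤
        ∫ ω, B * ∑ j ∈ K, ξ j ω ^ 2 - 2 * K.card * R ω - (K.card : ℝ) ^ 2 ∂P := by
      refine integral_mono_ae ((memLp_top_fun_sq mR).integrable le_top)
        (((iX.const_mul B).sub ((mR.integrable le_top).const_mul _)).sub (integrable_const _)) ?_
      filter_upwards [hB] with ω hω
      have h0 : 0 ≤ ∑ j ∈ K, ξ j ω ^ 2 := Finset.sum_nonneg fun j _ => sq_nonneg _
      simp only [hR]
      nlinarith [mul_nonneg h0 (sub_nonneg.2 hω)]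
    rw [integral_sub ((iX.const_mul B).sub' ((mR.integrable le_top).const_mul _))
        (integrable_const _),
      integral_sub (iX.const_mul B) ((mR.integrable le_top).const_mul _), integral_const_mul,
      integral_const_mul, R0, integral_sum_sq_of_isotropic K hξ hcov] at h1
    simp only [integral_const, probReal_univ, smul_eq_mul] at h1
    nlinarith [sq_nonneg (K.card : ℝ)]
  have key : ∫ ω, (∑ j ∈ K, (s j ω + ξ j ω) ^ 2 - (c + K.card)) ^ 2 ∂P =
      ∫ ω, Q ω ^ 2 + 4 * L ω ^ 2 + R ω ^ 2 + 4 * (Q ω * L ω) + 2 * (Q ω * R ω)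
        + 4 * (L ω * R ω) ∂P := by
    congr 1 with ω
    have : ∑ j ∈ K, (s j ω + ξ j ω) ^ 2 - (c + K.card) = Q ω + 2 * L ω + R ω := by
      simp only [hQ, hL, hR, add_sq, Finset.sum_add_distrib, mul_assoc, ← Finset.mul_sum]
      ring
    rw [this]
    ring
  have iQ := (memLp_top_fun_sq mQ).integrable le_top
  have iL := ((memLp_top_fun_sq mL).integrable le_top).const_mul 4
  have iR := (memLp_top_fun_sq mR).integrable le_top
  have iQL := ((memLp_top_fun_mul mQ mL).integrable le_top).const_mul 4
  have iQR := ((memLp_top_fun_mul mQ mR).integrable le_top).const_mul 2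
  have iLR := ((memLp_top_fun_mul mL mR).integrable le_top).const_mul 4
  rw [key, integral_add ((((iQ.fun_add iL).fun_add iR).fun_add iQL).fun_add iQR) iLR,
    integral_add (((iQ.fun_add iL).fun_add iR).fun_add iQL) iQR, integral_add ((iQ.fun_add iL).fun_add iR) iQL,
    integral_add (iQ.fun_add iL) iR, integral_add iQ iL, integral_const_mul, integral_const_mul,
    integral_const_mul, integral_const_mul, QL0, QR0, LR0, LL]
  linarith

end SecondMoment

/-! ### Moments of sums of i.i.d. isotropic vectors. -/

section PartialSums

variable {Ω 𝕐 : Type*} [MeasurableSpace Ω] [MeasurableSpace 𝕐] {P : Measure Ω}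
  {Y : ℕ → Ω → 𝕐} {l : ℕ → 𝕐 → ℝ}

lemma indepFun_partialSum (hY : ∀ i, Measurable (Y i)) (hindep : iIndepFun Y P)
    (hl : ∀ j, Measurable (l j)) (n : ℕ) :
    IndepFun (fun ω j => ∑ i ∈ Finset.range n, l j (Y i ω)) (fun ω j => l j (Y n ω)) P := by
  have h := hindep.indepFun_finset (Finset.range n) {n} (by simp) hY
  have hF : Measurable fun (y : Finset.range n → 𝕐) (j : ℕ) =>
      ∑ i : Finset.range n, l j (y i) := by fun_prop
  have hG : Measurable fun (y : ({n} : Finset ℕ) → 𝕐) (j : ℕ) =>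
      l j (y ⟨n, Finset.mem_singleton_self n⟩) := by fun_prop
  convert h.comp hF hG using 1
  · ext ω j
    exact (Finset.sum_coe_sort (Finset.range n) fun i => l j (Y i ω)).symm
  · rfl

/-- First and second moments of the squared norm of a sum of `n` independent copies of a bounded,
centred, isotropic vector. -/
lemma integral_sum_sq_partialSum [IsProbabilityMeasure P] (hY : ∀ i, Measurable (Y i))
    (hindep : iIndepFun Y P) (hident : ∀ i, IdentDistrib (Y i) (Y 0) P P)
    (hl : ∀ j, Measurable (l j))
    (hbdd : ∀ j, MemLp (fun ω => l j (Y 0 ω)) ∞ P)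
    (hmean : ∀ j, ∫ ω, l j (Y 0 ω) ∂P = 0)
    (hcov : ∀ i j, ∫ ω, l i (Y 0 ω) * l j (Y 0 ω) ∂P = if i = j then 1 else 0)
    (K : Finset ℕ) {B : ℝ} (hB : ∀ᵐ ω ∂P, ∑ j ∈ K, l j (Y 0 ω) ^ 2 ≤ B) (n : ℕ) :
    ∫ ω, ∑ j ∈ K, (∑ i ∈ Finset.range n, l j (Y i ω)) ^ 2 ∂P = n * K.card ∧
      ∫ ω, (∑ j ∈ K, (∑ i ∈ Finset.range n, l j (Y i ω)) ^ 2 - n * K.card) ^ 2 ∂P ≤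
        2 * n ^ 2 * K.card + n * K.card * B := by
  have hξ (i j : ℕ) : MemLp (fun ω => l j (Y i ω)) ∞ P :=
    ((hident i).comp (hl j)).memLp_iff.2 (hbdd j)
  have hξ0 (i j : ℕ) : ∫ ω, l j (Y i ω) ∂P = 0 :=
    ((hident i).comp (hl j)).integral_eq.trans (hmean j)
  have hξc (m i j : ℕ) : ∫ ω, l i (Y m ω) * l j (Y m ω) ∂P = if i = j then 1 else 0 :=
    ((hident m).comp ((hl i).mul (hl j))).integral_eq.trans (hcov i j)
  have hs (n j : ℕ) : MemLp (fun ω => ∑ i ∈ Finset.range n, l j (Y i ω)) ∞ P :=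
    memLp_finsetSum _ fun i _ => hξ i j
  have hs0 (n j : ℕ) : ∫ ω, ∑ i ∈ Finset.range n, l j (Y i ω) ∂P = 0 := by
    rw [integral_finsetSum _ fun i _ => (hξ i j).integrable le_top]
    simp [hξ0]
  have hξB (m : ℕ) : ∀ᵐ ω ∂P, ∑ j ∈ K, l j (Y m ω) ^ 2 ≤ B := by
    have hm : Measurable fun y => ∑ j ∈ K, l j y ^ 2 := by fun_prop
    exact ((hident m).symm.comp hm).ae_snd measurableSet_Iic hB
  induction n with
  | zero => simp
  | succ n ih =>
    have hind := indepFun_partialSum hY hindep hl n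
    have h1 := integral_sum_sq_add K (hs n) (hξ n) hind (hξ0 n) (hξc n)
    have h2 := integral_sq_sum_sq_add_sub_le K (hs n) (hξ n) hind (hs0 n) (hξ0 n) (hξc n)
      (hξB n) (n * K.card)
    simp only [Finset.sum_range_succ]
    rw [ih.1] at h1 h2
    push_cast
    refine ⟨h1.trans (by ring), ?_⟩
    rw [show ((n : ℝ) + 1) * K.card = n * K.card + K.card by ring]
    refine h2.trans ?_
    -- The increment `4n·card` fits into `2(n+1)²·card - 2n²·card`.
    nlinarith [ih.2, Nat.cast_nonneg (α := ℝ) K.card]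

end PartialSums

/-! ### The SNT-statistic and tail bounds for the selection rule. -/

section SNT

variable {Ω 𝕐 : Type*} (l : ℕ → 𝕐 → ℝ) (Y : ℕ → Ω → 𝕐)

lemma sntStatistic_eq (n k : ℕ) (ω : Ω) :
    sntStatistic l Y n k ω =
      (n : ℝ)⁻¹ * ∑ j ∈ Finset.range k, (∑ i ∈ Finset.range n, l j (Y i ω)) ^ 2 := by
  simp only [sntStatistic, mul_pow, ← Finset.mul_sum]
  rw [div_pow, Real.sq_sqrt (Nat.cast_nonneg n), one_pow, one_div]

lemma sntStatistic_nonneg (n k : ℕ) (ω : Ω) : 0 ≤ sntStatistic l Y n k ω :=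
  Finset.sum_nonneg fun _ _ => sq_nonneg _

lemma sntStatistic_mono (n : ℕ) (ω : Ω) : Monotone fun k => sntStatistic l Y n k ω :=
  fun _ _ h => Finset.sum_le_sum_of_subset_of_nonneg (Finset.range_mono h) fun _ _ _ => sq_nonneg _

lemma selectionRule_mem {d : ℕ → ℕ} {π : ℕ → ℕ → ℝ} (T : ℕ → ℕ → Ω → ℝ) {n : ℕ}
    (hd : 1 ≤ d n) (ω : Ω) :
    selectionRule d π T n ω ∈ Set.Icc 1 (d n) ∧ ∀ j ∈ Set.Icc 1 (d n),
      T n (selectionRule d π T n ω) ω - π (selectionRule d π T n ω) n ≥ T n j ω - π j n := by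
  refine Nat.sInf_mem (s := {k | k ∈ Set.Icc 1 (d n) ∧
    ∀ j ∈ Set.Icc 1 (d n), T n k ω - π k n ≥ T n j ω - π j n}) ?_
  obtain ⟨k, hk, hmax⟩ := Finset.exists_max_image (Finset.Icc 1 (d n))
    (fun k => T n k ω - π k n) ⟨1, by simpa using hd⟩
  exact ⟨k, by simpa using hk, fun j hj => hmax j (by simpa using hj)⟩

lemma two_mul_selectionRule_le {d : ℕ → ℕ} {π : ℕ → ℕ → ℝ} {n : ℕ} (hd : 1 ≤ d n)
    (hgap : ∀ k : ℕ, 2 ≤ k → k ≤ d n → 2 * (k : ℝ) ≤ π k n - π 1 n) (ω : Ω)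
    (h2 : 2 ≤ selectionRule d π (sntStatistic l Y) n ω) :
    2 * (selectionRule d π (sntStatistic l Y) n ω : ℝ) ≤
      sntStatistic l Y n (selectionRule d π (sntStatistic l Y) n ω) ω := by
  obtain ⟨hk, hmax⟩ := selectionRule_mem (π := π) (sntStatistic l Y) hd ω
  have h1 := hmax 1 ⟨le_rfl, hd⟩
  have h3 := hgap _ h2 hk.2
  have h4 := sntStatistic_nonneg l Y n 1 ω
  linarith

/-- If the selected dimension `S` is large, the SNT-statistic is large at the end of the block
`[m ^ 2, (m + 1) ^ 2)` containing `S`. -/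
lemma exists_le_sntStatistic_of_sq_le_selectionRule {d : ℕ → ℕ} {π : ℕ → ℕ → ℝ} {n : ℕ}
    (hd : 1 ≤ d n) (hgap : ∀ k : ℕ, 2 ≤ k → k ≤ d n → 2 * (k : ℝ) ≤ π k n - π 1 n) (ω : Ω)
    {p : ℕ} (hp : 1 ≤ p) (hω : (p + 1) ^ 2 ≤ selectionRule d π (sntStatistic l Y) n ω) :
    ∃ m ∈ Finset.Ioo p (d n + 1),
      2 * (m : ℝ) ^ 2 ≤ sntStatistic l Y n (min ((m + 1) ^ 2) (d n)) ω := by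
  have hS := (selectionRule_mem (π := π) (sntStatistic l Y) hd ω).1.2
  have h2 := two_mul_selectionRule_le l Y hd hgap ω (le_trans (by nlinarith) hω)
  generalize selectionRule d π (sntStatistic l Y) n ω = S at hω hS h2
  refine ⟨S.sqrt, Finset.mem_Ioo.2 ⟨Nat.le_sqrt'.2 hω,
    Nat.lt_succ_of_le ((Nat.sqrt_le_self S).trans hS)⟩, ?_⟩
  have hle : (S.sqrt : ℝ) ^ 2 ≤ S := by exact_mod_cast Nat.sqrt_le' S
  calc 2 * (S.sqrt : ℝ) ^ 2 ≤ 2 * S := by gcongr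
    _ ≤ sntStatistic l Y n S ω := h2
    _ ≤ _ := sntStatistic_mono l Y n ω (le_min (Nat.lt_succ_sqrt' S).le hS)

variable {l Y} [MeasurableSpace Ω] [MeasurableSpace 𝕐] {P : Measure Ω}

lemma memLp_top_sntStatistic (hl : ∀ j, Measurable (l j))
    (hident : ∀ i, IdentDistrib (Y i) (Y 0) P P)
    (hbdd : ∀ j, MemLp (fun ω => l j (Y 0 ω)) ∞ P) (n k : ℕ) :
    MemLp (fun ω => sntStatistic l Y n k ω) ∞ P :=
  memLp_top_sum_sq _ fun j => (memLp_finsetSum _ fun i _ =>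
    ((hident i).comp (hl j)).memLp_iff.2 (hbdd j)).const_mul _

variable [IsProbabilityMeasure P]

lemma integral_sntStatistic (hY : ∀ i, Measurable (Y i)) (hindep : iIndepFun Y P)
    (hident : ∀ i, IdentDistrib (Y i) (Y 0) P P) (hl : ∀ j, Measurable (l j))
    (hbdd : ∀ j, MemLp (fun ω => l j (Y 0 ω)) ∞ P)
    (hmean : ∀ j, ∫ ω, l j (Y 0 ω) ∂P = 0)
    (hcov : ∀ i j, ∫ ω, l i (Y 0 ω) * l j (Y 0 ω) ∂P = if i = j then 1 else 0)
    {n : ℕ} (hn : 1 ≤ n) {k : ℕ} {B : ℝ}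
    (hB : ∀ᵐ ω ∂P, ∑ j ∈ Finset.range k, l j (Y 0 ω) ^ 2 ≤ B) :
    ∫ ω, sntStatistic l Y n k ω ∂P = k ∧
      ∫ ω, (sntStatistic l Y n k ω - k) ^ 2 ∂P ≤ 2 * k + k * (B / n) := by
  have hn0 : (0 : ℝ) < n := by exact_mod_cast hn
  obtain ⟨h1, h2⟩ := integral_sum_sq_partialSum hY hindep hident hl hbdd hmean hcov _ hB n
  rw [Finset.card_range] at h1 h2
  simp only [sntStatistic_eq]
  refine ⟨by rw [integral_const_mul, h1, inv_mul_cancel_left₀ hn0.ne'], ?_⟩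
  have (x : ℝ) : ((n : ℝ)⁻¹ * x - k) ^ 2 = ((n : ℝ) ^ 2)⁻¹ * (x - n * k) ^ 2 := by
    field_simp
  simp only [this]
  rw [integral_const_mul]
  calc ((n : ℝ) ^ 2)⁻¹ * _ ≤ ((n : ℝ) ^ 2)⁻¹ * (2 * n ^ 2 * k + n * k * B) := by gcongr
    _ = _ := by field_simp

/-- Chebyshev's inequality for the SNT-statistic. -/
lemma measureReal_sntStatistic_ge_le (hY : ∀ i, Measurable (Y i)) (hindep : iIndepFun Y P)
    (hident : ∀ i, IdentDistrib (Y i) (Y 0) P P) (hl : ∀ j, Measurable (l j))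
    (hbdd : ∀ j, MemLp (fun ω => l j (Y 0 ω)) ∞ P)
    (hmean : ∀ j, ∫ ω, l j (Y 0 ω) ∂P = 0)
    (hcov : ∀ i j, ∫ ω, l i (Y 0 ω) * l j (Y 0 ω) ∂P = if i = j then 1 else 0)
    {n : ℕ} (hn : 1 ≤ n) {k : ℕ}
    (hB : ∀ᵐ ω ∂P, ∑ j ∈ Finset.range k, l j (Y 0 ω) ^ 2 ≤ n) {a : ℝ} (ha : 0 < a) :
    P.real {ω | k + a ≤ sntStatistic l Y n k ω} ≤ 3 * k / a ^ 2 := by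
  have h := (integral_sntStatistic hY hindep hident hl hbdd hmean hcov hn hB).2
  rw [div_self (by positivity)] at h
  have hint : Integrable (fun ω => (sntStatistic l Y n k ω - k) ^ 2) P :=
    (memLp_top_fun_sq ((memLp_top_sntStatistic hl hident hbdd n k).sub
      (memLp_const (k : ℝ)))).integrable le_top
  have hm := mul_meas_ge_le_integral_of_nonneg (ae_of_all _ fun _ => sq_nonneg _) hint (a ^ 2)
  have hsub : P.real {ω | k + a ≤ sntStatistic l Y n k ω} ≤
      P.real {ω | a ^ 2 ≤ (sntStatistic l Y n k ω - k) ^ 2} :=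
    measureReal_mono <| Set.ofPred_subset_ofPred.2 fun ω hω =>
      pow_le_pow_left₀ ha.le (by linarith) 2
  rw [le_div_iff₀ (by positivity)]
  nlinarith [mul_le_mul_of_nonneg_left hsub (sq_nonneg a)]

/-- Bounds one block. For `m ≥ 4` the block end satisfies `(m+1)² + m²/4 ≤ 2m²`, so the event is a
deviation of at least `m²/4`; also `(m+1)² ≤ (5/3)m²`, whence `80 = 3 · (5/3) · 16`. The cap at `D`
keeps the dimension where the norm bound holds. -/
lemma measureReal_sntStatistic_min_ge_le (hY : ∀ i, Measurable (Y i))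
    (hindep : iIndepFun Y P) (hident : ∀ i, IdentDistrib (Y i) (Y 0) P P)
    (hl : ∀ j, Measurable (l j)) (hbdd : ∀ j, MemLp (fun ω => l j (Y 0 ω)) ∞ P)
    (hmean : ∀ j, ∫ ω, l j (Y 0 ω) ∂P = 0)
    (hcov : ∀ i j, ∫ ω, l i (Y 0 ω) * l j (Y 0 ω) ∂P = if i = j then 1 else 0)
    {n : ℕ} (hn : 1 ≤ n) {D : ℕ}
    (hB : ∀ᵐ ω ∂P, ∑ j ∈ Finset.range D, l j (Y 0 ω) ^ 2 ≤ n) {m : ℕ} (hm : 4 ≤ m) :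
    P.real {ω | 2 * (m : ℝ) ^ 2 ≤ sntStatistic l Y n (min ((m + 1) ^ 2) D) ω} ≤
      80 * ((m : ℝ) ^ 2)⁻¹ := by
  have hm' : (4 : ℝ) ≤ m := by exact_mod_cast hm
  set k := min ((m + 1) ^ 2) D
  have hk : (k : ℝ) ≤ (m + 1) ^ 2 := by exact_mod_cast min_le_left _ _
  have hBk : ∀ᵐ ω ∂P, ∑ j ∈ Finset.range k, l j (Y 0 ω) ^ 2 ≤ n := by
    filter_upwards [hB] with ω hω
    exact (Finset.sum_le_sum_of_subset_of_nonneg (Finset.range_mono (min_le_right _ _))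
      fun _ _ _ => sq_nonneg _).trans hω
  have h := measureReal_sntStatistic_ge_le hY hindep hident hl hbdd hmean hcov hn hBk
    (a := (m : ℝ) ^ 2 / 4) (by positivity)
  calc P.real {ω | 2 * (m : ℝ) ^ 2 ≤ sntStatistic l Y n k ω}
      ≤ P.real {ω | k + (m : ℝ) ^ 2 / 4 ≤ sntStatistic l Y n k ω} :=
        measureReal_mono <| Set.ofPred_subset_ofPred.2 fun ω hω => le_trans (by nlinarith) hω
    _ ≤ 3 * k / ((m : ℝ) ^ 2 / 4) ^ 2 := h
    _ ≤ 3 * (5 / 3 * (m : ℝ) ^ 2) / ((m : ℝ) ^ 2 / 4) ^ 2 := by gcongr; nlinarith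
    _ = _ := by field_simp; norm_num

/-- Tail bound for the selection rule: the dimensions are grouped into the blocks
`[m ^ 2, (m + 1) ^ 2)`, on each of which the SNT-statistic is dominated by its value at the end. -/
lemma measureReal_selectionRule_ge_le (hY : ∀ i, Measurable (Y i)) (hindep : iIndepFun Y P)
    (hident : ∀ i, IdentDistrib (Y i) (Y 0) P P) (hl : ∀ j, Measurable (l j))
    (hbdd : ∀ j, MemLp (fun ω => l j (Y 0 ω)) ∞ P)
    (hmean : ∀ j, ∫ ω, l j (Y 0 ω) ∂P = 0)
    (hcov : ∀ i j, ∫ ω, l i (Y 0 ω) * l j (Y 0 ω) ∂P = if i = j then 1 else 0)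
    {d : ℕ → ℕ} {π : ℕ → ℕ → ℝ} {n : ℕ} (hn : 1 ≤ n) (hd : 1 ≤ d n)
    (hgap : ∀ k : ℕ, 2 ≤ k → k ≤ d n → 2 * (k : ℝ) ≤ π k n - π 1 n)
    (hB : 2 ≤ d n → ∀ᵐ ω ∂P, ∑ j ∈ Finset.range (d n), l j (Y 0 ω) ^ 2 ≤ n)
    {p : ℕ} (hp : 3 ≤ p) :
    P.real {ω | (p + 1) ^ 2 ≤ selectionRule d π (sntStatistic l Y) n ω} ≤ 160 / (p + 1) := by
  have hS (ω : Ω) := (selectionRule_mem (π := π) (sntStatistic l Y) hd ω).1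
  -- If `d n = 1`, then `S = 1` and no norm bound is needed.
  rcases hd.lt_or_eq with hd2 | hd1
  swap
  · have : {ω | (p + 1) ^ 2 ≤ selectionRule d π (sntStatistic l Y) n ω} = ∅ := by
      ext ω
      simp only [Set.mem_ofPred_eq, Set.mem_empty_iff_false, iff_false, not_le]
      exact (hS ω).2.trans_lt (by rw [← hd1]; exact Nat.one_lt_pow two_ne_zero (by omega))
    rw [this, measureReal_empty]
    positivity
  let A (m : ℕ) : Set Ω :=
    {ω | 2 * (m : ℝ) ^ 2 ≤ sntStatistic l Y n (min ((m + 1) ^ 2) (d n)) ω}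
  have hsub : {ω | (p + 1) ^ 2 ≤ selectionRule d π (sntStatistic l Y) n ω} ⊆
      ⋃ m ∈ Finset.Ioo p (d n + 1), A m := fun ω hω => by
    obtain ⟨m, hm, h⟩ := exists_le_sntStatistic_of_sq_le_selectionRule l Y hd hgap ω
      (by omega) hω
    exact Set.mem_biUnion hm h
  have hA (m : ℕ) (hm : m ∈ Finset.Ioo p (d n + 1)) : P.real (A m) ≤ 80 * ((m : ℝ) ^ 2)⁻¹ :=
    measureReal_sntStatistic_min_ge_le hY hindep hident hl hbdd hmean hcov hn (hB hd2)
      (by have := (Finset.mem_Ioo.1 hm).1; omega)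
  calc P.real {ω | (p + 1) ^ 2 ≤ selectionRule d π (sntStatistic l Y) n ω}
      ≤ P.real (⋃ m ∈ Finset.Ioo p (d n + 1), A m) := measureReal_mono hsub (measure_ne_top P _)
    _ ≤ ∑ m ∈ Finset.Ioo p (d n + 1), P.real (A m) := measureReal_biUnion_finset_le _ A
    _ ≤ ∑ m ∈ Finset.Ioo p (d n + 1), 80 * ((m : ℝ) ^ 2)⁻¹ := Finset.sum_le_sum hA
    _ = 80 * ∑ m ∈ Finset.Ioo p (d n + 1), ((m : ℝ) ^ 2)⁻¹ := by rw [Finset.mul_sum]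
    _ ≤ 80 * (2 / (p + 1)) := by
        gcongr
        exact sum_Ioo_inv_sq_le p (d n + 1)
    _ = 160 / (p + 1) := by ring

end SNT

theorem mainTheorem7 {Ω 𝕐 : Type*} [MeasurableSpace Ω] [MeasurableSpace 𝕐]
    (P₀ : Measure Ω) [IsProbabilityMeasure P₀]
    (Y : ℕ → Ω → 𝕐) (hY : ∀ i, Measurable (Y i))
    (hindep : iIndepFun Y P₀) (hident : ∀ i, IdentDistrib (Y i) (Y 0) P₀ P₀)
    (l : ℕ → 𝕐 → ℝ) (hl : ∀ j, Measurable (l j))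
    (hmean : ∀ j, ∫ ω, l j (Y 0 ω) ∂P₀ = 0)
    (hcov : ∀ k : ℕ, Matrix.of (fun i j : Fin k =>
      covariance (fun ω => l i (Y 0 ω)) (fun ω => l j (Y 0 ω)) P₀) = 1)
    (M : ℕ → ℝ)
    (hM : ∀ k : ℕ, 1 ≤ k →
      ∀ᵐ ω ∂P₀, ‖(WithLp.toLp 2 (fun j : Fin k => l j (Y 0 ω)) : EuclideanSpace ℝ (Fin k))‖ ≤ M k)
    (d : ℕ → ℕ) (π : ℕ → ℕ → ℝ) (hπ : IsPenalty d π)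
    (hπ_nonneg : ∀ n, 1 ≤ n → 0 ≤ π 1 n)
    (hπ_gap : ∀ n k, 1 ≤ n → 2 ≤ k → k ≤ d n → 2 * (k : ℝ) ≤ π k n - π 1 n)
    (hlim : Tendsto (fun n : ℕ => M (d n) * π (d n) n / √(n : ℝ)) atTop (𝓝 0)) :
    IsBoundedInProbability P₀
        (fun n ω => (selectionRule d π (sntStatistic l Y) n ω : ℝ)) ∧
      IsBoundedInProbability P₀
        (fun n ω => sntStatistic l Y n (selectionRule d π (sntStatistic l Y) n ω) ω) := by
  have hB (k : ℕ) (hk : 1 ≤ k) : ∀ᵐ ω ∂P₀, ∑ j ∈ Finset.range k, l j (Y 0 ω) ^ 2 ≤ M k ^ 2 := by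
    filter_upwards [hM k hk] with ω hω
    have h := pow_le_pow_left₀ (norm_nonneg _) hω 2
    rw [EuclideanSpace.norm_sq_eq] at h
    simpa [← Fin.sum_univ_eq_sum_range (fun j => l j (Y 0 ω) ^ 2)] using h
  have hbdd (j : ℕ) : MemLp (fun ω => l j (Y 0 ω)) ∞ P₀ := by
    refine memLp_top_of_bound ((hl j).comp (hY 0)).aestronglyMeasurable |M (j + 1)| ?_
    filter_upwards [hB (j + 1) (by omega)] with ω hω
    refine sq_le_sq.1 (le_trans ?_ hω)
    exact Finset.single_le_sum (f := fun j => l j (Y 0 ω) ^ 2) (fun _ _ => sq_nonneg _)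
      (Finset.self_mem_range_succ j)
  have hcov' (i j : ℕ) : ∫ ω, l i (Y 0 ω) * l j (Y 0 ω) ∂P₀ = if i = j then 1 else 0 := by
    have h := congrFun (congrFun (hcov (max i j + 1)) ⟨i, by omega⟩) ⟨j, by omega⟩
    simpa [covariance, hmean, Matrix.one_apply] using h
  have hMn : ∀ᶠ n : ℕ in atTop, 1 ≤ n ∧
      (2 ≤ d n → ∀ᵐ ω ∂P₀, ∑ j ∈ Finset.range (d n), l j (Y 0 ω) ^ 2 ≤ n) := by
    filter_upwards [eventually_ge_atTop 1, hlim.eventually (Metric.ball_mem_nhds 0 one_pos)]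
      with n hn hlt
    refine ⟨hn, fun hd => ?_⟩
    have hn0 : (0 : ℝ) < √n := Real.sqrt_pos.2 (by exact_mod_cast hn)
    -- A penalty bounded below turns the limit condition into `|M (d n)| ≤ √n`; the gap supplies
    -- this only when `d n ≥ 2`.
    have hπ1 : 1 ≤ π (d n) n := by
      have h1 := hπ_gap n (d n) hn hd le_rfl
      have h2 := hπ_nonneg n hn
      have h3 : (2 : ℝ) ≤ d n := by exact_mod_cast hd
      linarith
    have hlt' : |M (d n)| * π (d n) n < √n := by
      rw [dist_zero_right, Real.norm_eq_abs, abs_div, abs_of_pos hn0,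
        div_lt_one hn0, abs_mul, abs_of_pos (zero_lt_one.trans_le hπ1)] at hlt
      exact hlt
    have hle : |M (d n)| ≤ √n := by nlinarith [abs_nonneg (M (d n))]
    filter_upwards [hB (d n) (by omega)] with ω hω
    refine hω.trans ?_
    rw [← sq_abs, ← Real.sq_sqrt (Nat.cast_nonneg (α := ℝ) n)]
    exact pow_le_pow_left₀ (abs_nonneg _) hle 2
  have htail (ε : ℝ) (hε : 0 < ε) : ∃ N : ℕ, 1 ≤ N ∧ ∀ᶠ n in atTop,
      P₀.real {ω | N ≤ selectionRule d π (sntStatistic l Y) n ω} ≤ ε := by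
    obtain ⟨q, hq⟩ := exists_nat_gt (160 / ε)
    refine ⟨(max q 3 + 1) ^ 2, Nat.one_le_pow _ _ (by omega), ?_⟩
    filter_upwards [hMn] with n hn
    refine (measureReal_selectionRule_ge_le hY hindep hident hl hbdd hmean hcov' hn.1
      (hπ.one_le n hn.1) (fun k => hπ_gap n k hn.1) hn.2 (le_max_right q 3)).trans ?_
    rw [div_le_iff₀ (by positivity)]
    rw [div_lt_iff₀ hε] at hq
    have : (q : ℝ) ≤ (max q 3 : ℕ) := by exact_mod_cast le_max_left q 3
    nlinarith
  refine ⟨fun ε hε => ?_, fun ε hε => ?_⟩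
  · obtain ⟨N, -, hN⟩ := htail ε hε
    refine ⟨N, ?_⟩
    simpa using hN
  · obtain ⟨N, hN1, hN⟩ := htail (ε / 2) (half_pos hε)
    have hN0 : (0 : ℝ) < N := by exact_mod_cast hN1
    -- As `T_N` has mean `N`, Markov's inequality at this level gives `ε / 2`.
    refine ⟨2 * N / ε, ?_⟩
    filter_upwards [hN, eventually_ge_atTop 1] with n hn hn1
    have hmarkov := mul_meas_ge_le_integral_of_nonneg (μ := P₀)
      (ae_of_all _ (sntStatistic_nonneg l Y n N))
      ((memLp_top_sntStatistic hl hident hbdd n N).integrable le_top) (2 * N / ε)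
    rw [(integral_sntStatistic hY hindep hident hl hbdd hmean hcov' hn1 (hB N hN1)).1] at hmarkov
    have hT : P₀.real {ω | 2 * N / ε ≤ sntStatistic l Y n N ω} ≤ ε / 2 := by
      have hpos : 0 < 2 * N / ε := by positivity
      refine le_of_mul_le_mul_left (hmarkov.trans_eq ?_) hpos
      field_simp
    calc _ ≤ P₀.real ({ω | N ≤ selectionRule d π (sntStatistic l Y) n ω} ∪
          {ω | 2 * N / ε ≤ sntStatistic l Y n N ω}) := by
          refine measureReal_mono fun ω hω => ?_
          rw [Set.mem_ofPred_eq, abs_of_nonneg (sntStatistic_nonneg _ _ _ _ _)] at hω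
          rcases le_total N (selectionRule d π (sntStatistic l Y) n ω) with h | h
          · exact Or.inl h
          · exact Or.inr (hω.trans (sntStatistic_mono l Y n ω h))
      _ ≤ ε / 2 + ε / 2 := (measureReal_union_le _ _).trans (add_le_add hn hT)
      _ = ε := add_halves ε
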